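/- A stochastic game is a tuple $\mathcal G=(V,(V_1,V_2,V_{\mathsf P}),\delta)$, where $V$ is a finite set of vertices, $V_1,V_2,V_{\mathsf P}$ is a partition of $V$ (with possibly empty classes), and $\delta:V\times V\to[0,1]$ satisfies $\delta(v,v')\in\{0,1\}$ for all $v\in V_1\cup V_2$, $v'\in V$, and $\sum_{v'\in V}\delta(v,v')=1$ for all $v\in V_{\mathsf P}$; moreover $\mathrm{post}(v)=\{v'\in V:\delta(v,v')>0\}$ is non-empty for every $v\in V$. A vertex $v$ is terminal if $\delta(v,v)=1$ and $\delta(v,v')=0$ for all $v'\neq v$; let $T$ be the set of terminal vertices. A path is an infinite sequence $\omega=\omega_0\omega_1\cdots$ of vertices with $\delta(\omega_k,\omega_{k+1})>0$ for all $k$. A strategy of Player $i\in\{1,2\}$ is a function $\pi_i$ that assigns to every finite sequence $\hat\omega v\in V^*V_i$ a probability distribution $\pi_i(\hat\omega v)$ on $V$ with $\pi_i(\hat\omega v)(v')>0$ only if $v'\in\mathrm{post}(v)$. Strategies $\pi_1,\pi_2$ and an initial vertex $v$ determine a probability measure $\mathrm{Prob}^{\pi_1,\pi_2}_{v}$ on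 infinite plays (with the $\sigma$-algebra generated by the cylinders): the play starts at $v$, and after the history $\hat\omega u$ the next vertex has distribution $\pi_i(\hat\omega u)$ if $u\in V_i$, $i\in\{1,2\}$, and $\delta(u,\cdot)$ if $u\in V_{\mathsf P}$. Let $\Diamond T$ be the set of paths that visit $T$. With $\inf(\omega)$ the set of vertices that occur infinitely often in $\omega$, a path $\omega$ is fair if $\mathrm{post}(v')\subseteq\inf(\omega)$ for every $v'\in V_2\cap\inf(\omega)$. A Player 2 strategy $\pi_2$ is fair if $\mathrm{Prob}^{\pi_1,\pi_2}_{v}(\{\omega:\omega\text{ is a fair path}\})=1$ for every Player 1 strategy $\pi_1$ and every $v\in V$. The game is stopping under fairness if $\mathrm{Prob}^{\pi_1,\pi_2}_{v}(\Diamond T)=1$ for every Player 1 strategy $\pi_1$, every fair Player 2 strategy $\pi_2$ and every $v\in V$. For $C\subseteq V$ put $\delta(v,C)=\sum_{v'\in C}\delta(v,v')$ and $$\exists\mathrm{Pre}_f(C)=\{v\in V:\delta(v,C)>0\},$$ $$\forall\mathrm{Pre}_f(C)=\{v\in V_2\cup V_{\mathsf P}:\delta(v,C)>0\}\cup\{v\in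 V_1:\forall v'\in V,\ \delta(v,v')>0\Rightarrow v'\in C\},$$ and let $\exists\mathrm{Pre}_f^*(C)$ (respectively $\forall\mathrm{Pre}_f^*(C)$) be the least set that contains $C$ and is closed under $\exists\mathrm{Pre}_f$ (respectively $\forall\mathrm{Pre}_f$). **Theorem.** Let $\mathcal G=(V,(V_1,V_2,V_{\mathsf P}),\delta)$ be a stochastic game and $T$ its set of terminal vertices. Then: 1. for every $v\in V$, $\mathrm{Prob}^{\pi_1,\pi_2}_{v}(\Diamond T)=1$ holds for every Player 1 strategy $\pi_1$ and every fair Player 2 strategy $\pi_2$ if and only if $v\in V\setminus\exists\mathrm{Pre}_f^*(V\setminus\forall\mathrm{Pre}_f^*(T))$; 2. $\mathcal G$ is stopping under fairness if and only if $\exists\mathrm{Pre}_f^*(V\setminus\forall\mathrm{Pre}_f^*(T))=\emptyset$. -/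

import Mathlib

open MeasureTheory ProbabilityTheory Filter
open scoped ENNReal

/-- Who controls a vertex: Player 1, Player 2, or chance (a probabilistic vertex). -/
inductive Owner
  | player1
  | player2
  | chance

/-- A stochastic game `(V, (V₁, V₂, V_P), δ)` over a finite vertex set. The partition of `V` is given
by the map `owner`, whose fibres are the (possibly empty) sets `V₁`, `V₂`, `V_P`. -/
structure StochasticGame (V : Type*) [Fintype V] where
  /-- the class of the partition a vertex lies in -/
  owner : V → Owner
  /-- the transition function `δ : V × V → [0, 1]` -/
  δ : V → V → ℝ
  δ_mem : ∀ v v', δ v v' ∈ Set.Icc (0 : ℝ) 1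
  δ_player : ∀ v, owner v ≠ Owner.chance → ∀ v', δ v v' = 0 ∨ δ v v' = 1
  δ_chance : ∀ v, owner v = Owner.chance → ∑ v', δ v v' = 1
  exists_succ : ∀ v, ∃ v', 0 < δ v v'

namespace StochasticGame

variable {V : Type*} [Fintype V] (G : StochasticGame V)

/-- The successors of a vertex. -/
def post (v : V) : Set V := {v' | 0 < G.δ v v'}

/-- The set of terminal vertices. -/
def terminal : Set V := {v | G.δ v v = 1 ∧ ∀ v', v ≠ v' → G.δ v v' = 0}

/-- The paths of the game: infinite sequences all of whose steps are transitions. -/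
def paths : Set (ℕ → V) := {ω | ∀ k, 0 < G.δ (ω k) (ω (k + 1))}

/-- A strategy for the player `i`: a function `V* Vᵢ → 𝒟(V)`. The first argument is the sequence of
vertices visited before the current vertex, in order; the second one is the current vertex. -/
structure Strategy (i : Owner) where
  /-- the distribution of the next vertex -/
  next : List V → {v : V // G.owner v = i} → PMF V
  next_supp : ∀ h v v', 0 < next h v v' → v' ∈ G.post v.1

/-- The distribution `δ(v, ·)` at a probabilistic vertex. -/
noncomputable def chanceDist (v : V) (hv : G.owner v = Owner.chance) : PMF V :=
  PMF.ofFintype (fun v' => ENNReal.ofReal (G.δ v v')) (by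
    rw [← ENNReal.ofReal_sum_of_nonneg (fun v' _ => (G.δ_mem v v').1), G.δ_chance v hv,
      ENNReal.ofReal_one])

variable {G} in
/-- The distribution of the next vertex when the vertices in `h` were visited, in order, before the
current vertex `v`. -/
noncomputable def step (σ₁ : G.Strategy Owner.player1) (σ₂ : G.Strategy Owner.player2)
    (h : List V) (v : V) : PMF V :=
  match hv : G.owner v with
  | Owner.player1 => σ₁.next h ⟨v, hv⟩
  | Owner.player2 => σ₂.next h ⟨v, hv⟩
  | Owner.chance => G.chanceDist v hv

section Measure

variable [MeasurableSpace V] [DiscreteMeasurableSpace V]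

variable {G} in
/-- The transition kernel at time `n`: from the first `n + 1` vertices of the play to the next one. -/
noncomputable def stepKernel (σ₁ : G.Strategy Owner.player1) (σ₂ : G.Strategy Owner.player2)
    (n : ℕ) : Kernel ((_ : Finset.Iic n) → V) V :=
  Kernel.ofFunOfCountable fun x =>
    (step σ₁ σ₂
      (List.ofFn fun i : Fin n => x ⟨i.1, Finset.mem_Iic.2 i.2.le⟩)
      (x ⟨n, Finset.mem_Iic.2 le_rfl⟩)).toMeasure

instance (σ₁ : G.Strategy Owner.player1) (σ₂ : G.Strategy Owner.player2) (n : ℕ) :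
    IsMarkovKernel (stepKernel σ₁ σ₂ n) :=
  ⟨fun x => by
    simp only [stepKernel, Kernel.ofFunOfCountable, Kernel.coe_mk]
    infer_instance⟩

variable {G} in
/-- The probability measure on infinite plays obtained by fixing the two strategies and the initial
vertex (through the Ionescu-Tulcea theorem), on the σ-algebra generated by the cylinders. -/
noncomputable def prob (σ₁ : G.Strategy Owner.player1) (σ₂ : G.Strategy Owner.player2) (v : V) :
    Measure (ℕ → V) :=
  Kernel.traj (X := fun _ => V) (stepKernel σ₁ σ₂) 0 (fun _ => v)

end Measure

/-- The event `◇ S`: paths that visit `S`. -/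
def reach (S : Set V) : Set (ℕ → V) := {ω | ω ∈ G.paths ∧ ∃ i, ω i ∈ S}

/-- `inf(ω)`: the vertices that occur infinitely often in `ω`. -/
def infOften (ω : ℕ → V) : Set V := {v | ∃ᶠ n in atTop, ω n = v}

/-- The fair plays for Player 2. -/
def fairPlays : Set (ℕ → V) :=
  {ω | ω ∈ G.paths ∧
    ∀ v', G.owner v' = Owner.player2 → v' ∈ infOften ω → G.post v' ⊆ infOften ω}

variable {G} in
/-- A Player 2 strategy is (almost-surely) fair if against every Player 1 strategy and from every
initial vertex, the play is fair with probability one. -/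
def Strategy.IsFair [MeasurableSpace V] [DiscreteMeasurableSpace V]
    (σ₂ : G.Strategy Owner.player2) : Prop :=
  ∀ (σ₁ : G.Strategy Owner.player1) (v : V), prob σ₁ σ₂ v G.fairPlays = 1

/-- A game is stopping under fairness if a terminal vertex is reached almost surely from every vertex,
for every Player 1 strategy and every fair Player 2 strategy. -/
def StoppingUnderFairness [MeasurableSpace V] [DiscreteMeasurableSpace V] : Prop :=
  ∀ (σ₁ : G.Strategy Owner.player1) (σ₂ : G.Strategy Owner.player2), σ₂.IsFair →
    ∀ v : V, prob σ₁ σ₂ v (G.reach G.terminal) = 1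

/-- `δ(v, C)`, the sum of `δ(v, v')` over `v' ∈ C`. -/
noncomputable def δSet (v : V) (C : Set V) : ℝ := ∑ v', C.indicator (G.δ v) v'

/-- The operator `∃Pre_f`. -/
def existsPre (C : Set V) : Set V := {v | 0 < G.δSet v C}

/-- The operator `∀Pre_f`. -/
def forallPre (C : Set V) : Set V :=
  {v | (G.owner v = Owner.player2 ∨ G.owner v = Owner.chance) ∧ 0 < G.δSet v C} ∪
  {v | G.owner v = Owner.player1 ∧ ∀ v', 0 < G.δ v v' → v' ∈ C}

end StochasticGame

/-- The (reflexive and transitive) closure `Pre*` of a predecessor operator: `Pre* C` is the least set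
that contains `C` and is closed under `Pre`. -/
def preStar {V : Type*} (Pre : Set V → Set V) (C : Set V) : Set V :=
  ⋂₀ {X | C ⊆ X ∧ Pre X ⊆ X}

/-! Let W be the least fixed point `preStar G.forallPre G.terminal` and U its complement. Off
`preStar G.existsPre U` a path never leaves W. Almost surely it is fair at Player 2 vertices by
hypothesis, and at chance vertices by Lévy's conditional Borel–Cantelli lemma. If it missed T,
induction along W would show that no vertex of W recurs (`disjoint_infOften_of_fair`); but V is
finite, so some vertex recurs. Conversely, Player 2 and chance vertices of U have no successor in W,
and Player 1 vertices of U have a successor in U. Player 1 moves within U once there and uniformly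
over all successors elsewhere; Player 2 moves uniformly, which is fair. From a vertex of `preStar
G.existsPre U`, a finite prefix of positive probability enters U. The play then stays in U, and T is
absorbing and disjoint from U, so T is never visited. -/

namespace StochasticGame

variable {V : Type*} [Fintype V] {G : StochasticGame V}

/-! ### One-step distributions and memoryless strategies -/

section Step

variable (σ₁ : G.Strategy Owner.player1) (σ₂ : G.Strategy Owner.player2) (h : List V) {v : V}

lemma step_of_player1 (hv : G.owner v = Owner.player1) :
    step σ₁ σ₂ h v = σ₁.next h ⟨v, hv⟩ := by
  unfold step
  split <;> rename_i h' <;> first | rfl | exact absurd (hv.symm.trans h') (by simp)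

lemma step_of_player2 (hv : G.owner v = Owner.player2) :
    step σ₁ σ₂ h v = σ₂.next h ⟨v, hv⟩ := by
  unfold step
  split <;> rename_i h' <;> first | rfl | exact absurd (hv.symm.trans h') (by simp)

lemma step_of_chance (hv : G.owner v = Owner.chance) :
    step σ₁ σ₂ h v = G.chanceDist v hv := by
  unfold step
  split <;> rename_i h' <;> first | rfl | exact absurd (hv.symm.trans h') (by simp)

lemma step_of_chance_apply (hv : G.owner v = Owner.chance) (w : V) :
    step σ₁ σ₂ h v w = ENNReal.ofReal (G.δ v w) := by
  rw [step_of_chance σ₁ σ₂ h hv]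
  rfl

lemma mem_post_of_step_pos {w : V} (hw : 0 < step σ₁ σ₂ h v w) : w ∈ G.post v := by
  cases hv : G.owner v with
  | player1 => rw [step_of_player1 σ₁ σ₂ h hv] at hw; exact σ₁.next_supp _ _ _ hw
  | player2 => rw [step_of_player2 σ₁ σ₂ h hv] at hw; exact σ₂.next_supp _ _ _ hw
  | chance => rw [step_of_chance_apply σ₁ σ₂ h hv] at hw; exact ENNReal.ofReal_pos.1 hw

end Step

/-- The memoryless strategy that moves from `v` to a vertex of `S v` chosen uniformly. -/
noncomputable def uniformStrategy (i : Owner) (S : V → Finset V) (hS : ∀ v, (S v).Nonempty)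
    (hpost : ∀ v, ↑(S v) ⊆ G.post v) : G.Strategy i where
  next _ v := PMF.uniformOfFinset (S v.1) (hS v.1)
  next_supp _ v w hw := hpost v.1 <| by
    by_contra hn
    rw [PMF.uniformOfFinset_apply_of_notMem _ hn] at hw
    exact lt_irrefl _ hw

lemma uniformStrategy_next_pos {i : Owner} {S : V → Finset V} {hS : ∀ v, (S v).Nonempty}
    {hpost : ∀ v, ↑(S v) ⊆ G.post v} (h : List V) (v : {v // G.owner v = i}) {w : V} :
    0 < (uniformStrategy i S hS hpost).next h v w ↔ w ∈ S v.1 := by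
  rw [uniformStrategy, PMF.uniformOfFinset_apply]
  split_ifs with hw <;> simp [hw]

/-- Independence of the history is recorded because it bounds move probabilities below uniformly
over histories, as fairness needs. -/
lemma exists_strategy_next (i : Owner) (S : V → Set V) (hS : ∀ v, (S v).Nonempty)
    (hpost : ∀ v, S v ⊆ G.post v) :
    ∃ σ : G.Strategy i, (∀ h v w, 0 < σ.next h v w ↔ w ∈ S v.1) ∧
      ∀ h h' v, σ.next h v = σ.next h' v := by
  classical
  refine ⟨uniformStrategy i (fun v => (S v).toFinset) (fun v => by simpa using hS v)
    (fun v => by simpa using hpost v), fun h v w => ?_, fun _ _ _ => rfl⟩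
  rw [uniformStrategy_next_pos, Set.mem_toFinset]

/-! ### The measure on plays, recurrence and fairness -/

section Measure

variable [MeasurableSpace V] [DiscreteMeasurableSpace V]
  (σ₁ : G.Strategy Owner.player1) (σ₂ : G.Strategy Owner.player2)

/-- The vertices visited by `ω` strictly before time `n`. -/
def history (n : ℕ) (ω : ℕ → V) : List V := List.ofFn fun i : Fin n => ω i

instance (v : V) : IsProbabilityMeasure (prob σ₁ σ₂ v) := by
  unfold prob
  infer_instance

lemma stepKernel_frestrictLe_singleton (n : ℕ) (ω : ℕ → V) (w : V) :
    stepKernel σ₁ σ₂ n (Preorder.frestrictLe n ω) {w} =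
      step σ₁ σ₂ (history n ω) (ω n) w := by
  simp only [stepKernel, Kernel.ofFunOfCountable, Kernel.coe_mk]
  rw [PMF.toMeasure_apply_singleton _ _ (measurableSet_singleton w)]
  rfl

/-- The one-step disintegration of the Ionescu-Tulcea measure, behind both the support statement and
the prefix estimate below. -/
lemma map_prob_compProd_stepKernel (v : V) (n : ℕ) :
    (prob σ₁ σ₂ v).map (Preorder.frestrictLe (π := fun _ => V) n) ⊗ₘ stepKernel σ₁ σ₂ n =
      (prob σ₁ σ₂ v).map (fun ω => (Preorder.frestrictLe n ω, ω (n + 1))) := by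
  have := Kernel.partialTraj_compProd_eq_map_traj (X := fun _ => V)
    (κ := stepKernel σ₁ σ₂) (Nat.zero_le n) (x₀ := fun _ => v)
  rw [← Kernel.traj_map_frestrictLe_apply] at this
  exact this

lemma ae_step_pos (v : V) :
    ∀ᵐ ω ∂prob σ₁ σ₂ v, ∀ n, 0 < step σ₁ σ₂ (history n ω) (ω n) (ω (n + 1)) := by
  rw [ae_all_iff]
  intro n
  have hmeas : MeasurableSet {p : ((_ : Finset.Iic n) → V) × V | 0 < stepKernel σ₁ σ₂ n p.1 {p.2}} :=
    .of_discrete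
  have key : ∀ᵐ p ∂((prob σ₁ σ₂ v).map (Preorder.frestrictLe (π := fun _ => V) n) ⊗ₘ
      stepKernel σ₁ σ₂ n), 0 < stepKernel σ₁ σ₂ n p.1 {p.2} := by
    rw [Measure.ae_compProd_iff hmeas]
    refine Eventually.of_forall fun x => ?_
    rw [ae_iff_of_countable]
    exact fun w hw => pos_iff_ne_zero.2 hw
  rw [map_prob_compProd_stepKernel, ae_map_iff (by fun_prop) hmeas] at key
  filter_upwards [key] with ω hω
  rwa [← stepKernel_frestrictLe_singleton]

lemma ae_eq_start (v : V) : ∀ᵐ ω ∂prob σ₁ σ₂ v, ω 0 = v := by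
  have h0 : (prob σ₁ σ₂ v).map (Preorder.frestrictLe (π := fun _ => V) 0) =
      Measure.dirac (fun _ => v) := by
    rw [prob, Kernel.traj_map_frestrictLe_apply, Kernel.partialTraj_self, Kernel.id_apply]
  have h1 : ∀ᵐ x ∂(Measure.dirac (fun _ => v) : Measure ((_ : Finset.Iic 0) → V)),
      x ⟨0, by simp⟩ = v := by
    rw [ae_dirac_eq]; rfl
  rw [← h0] at h1
  exact ae_of_ae_map (by fun_prop) h1

lemma prob_prefix_pos {v : V} (p : ℕ → V) (hp : p 0 = v) (n : ℕ)
    (hstep : ∀ i < n, 0 < step σ₁ σ₂ (history i p) (p i) (p (i + 1))) :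
    0 < prob σ₁ σ₂ v {ω | ∀ i ≤ n, ω i = p i} := by
  induction n with
  | zero =>
    have h1 : {ω : ℕ → V | ∀ i ≤ 0, ω i = p i} ∈ ae (prob σ₁ σ₂ v) := by
      filter_upwards [ae_eq_start σ₁ σ₂ v] with ω hω i hi
      obtain rfl : i = 0 := by omega
      rw [hω, hp]
    rw [(measure_congr (eventuallyEq_univ.2 h1) :), measure_univ]
    exact one_pos
  | succ n ih =>
    -- On this rectangle the disintegration reads: prefix probability times step probability equals
    -- the probability of the longer prefix.
    have h1 := congrArg (fun μ => μ ({Preorder.frestrictLe n p} ×ˢ {p (n + 1)}))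
      (map_prob_compProd_stepKernel σ₁ σ₂ v n)
    rw [Measure.compProd_apply_prod (measurableSet_singleton _) (measurableSet_singleton _),
      lintegral_singleton, stepKernel_frestrictLe_singleton,
      Measure.map_apply (by fun_prop) (measurableSet_singleton _),
      Measure.map_apply (by fun_prop)
        ((measurableSet_singleton _).prod (measurableSet_singleton _))] at h1
    have h2 := ENNReal.mul_pos (hstep n n.lt_succ_self).ne'
      (ih fun i hi => hstep i (hi.trans n.lt_succ_self)).ne'
    have h3 : {ω : ℕ → V | ∀ i ≤ n, ω i = p i} =
        Preorder.frestrictLe (π := fun _ => V) n ⁻¹' {Preorder.frestrictLe n p} := by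
      ext ω
      simp [funext_iff]
    rw [h3, h1] at h2
    refine lt_of_lt_of_le h2 (measure_mono fun ω hω i hi => ?_)
    simp only [Set.mem_preimage, Set.mem_prod, Set.mem_singleton_iff] at hω
    rcases Nat.le_succ_iff.1 hi with hi | rfl
    · exact congrFun hω.1 ⟨i, by simpa using hi⟩
    · exact hω.2

lemma condExp_indicator_next (v w : V) (n : ℕ) :
    (prob σ₁ σ₂ v)[({ω : ℕ → V | ω (n + 1) = w}).indicator (1 : (ℕ → V) → ℝ) |
        Filtration.piLE (X := fun _ => V) n] =ᵐ[prob σ₁ σ₂ v]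
      fun ω => (step σ₁ σ₂ (history n ω) (ω n) w).toReal := by
  have hm : MeasurableSet {ω : ℕ → V | ω (n + 1) = w} :=
    measurableSet_eq_fun (by fun_prop) measurable_const
  have hint : Integrable (({ω : ℕ → V | ω (n + 1) = w}).indicator (1 : (ℕ → V) → ℝ))
      (prob σ₁ σ₂ v) := (integrable_const 1).indicator hm
  refine (Kernel.condExp_traj (X := fun _ => V) (κ := stepKernel σ₁ σ₂) (Nat.zero_le n)
    (x₀ := fun _ => v) hint).trans (Eventually.of_forall fun ω => ?_)
  simp only
  rw [integral_indicator_one hm, ← stepKernel_frestrictLe_singleton,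
    ← Kernel.map_traj_succ_self (X := fun _ => V) (κ := stepKernel σ₁ σ₂) (a := n),
    Kernel.map_apply' _ (by fun_prop) _ (measurableSet_singleton w)]
  rfl

/-- By Lévy's conditional Borel–Cantelli lemma, w recurs as soon as the conditional probabilities of
moving to w have a divergent sum; each visit to u contributes at least c. -/
lemma ae_infOften_of_step_ge (v u w : V) {c : ℝ≥0∞} (hc : 0 < c)
    (hstep : ∀ h, c ≤ step σ₁ σ₂ h u w) :
    ∀ᵐ ω ∂prob σ₁ σ₂ v, u ∈ infOften ω → w ∈ infOften ω := by
  have hs : ∀ n, MeasurableSet[Filtration.piLE (X := fun _ => V) n] {ω : ℕ → V | ω n = w} := by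
    intro n
    rw [Filtration.piLE_eq_comap_frestrictLe]
    exact ⟨{x | x ⟨n, by simp⟩ = w}, .of_discrete, rfl⟩
  have hc' : 0 < c.toReal := ENNReal.toReal_pos hc.ne'
    (((hstep []).trans (PMF.coe_le_one _ _)).trans_lt ENNReal.one_lt_top).ne
  filter_upwards [ae_mem_limsup_atTop_iff (prob σ₁ σ₂ v) hs,
    ae_all_iff.2 (condExp_indicator_next σ₁ σ₂ v w)] with ω h1 h2 hu
  have h3 : ω ∈ limsup (fun n => {ω : ℕ → V | ω n = w}) atTop := by
    rw [h1]
    simp only [h2]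
    have hmono : Tendsto (fun n => ∑ k ∈ Finset.range n,
        ({k | ω k = u}).indicator (fun _ => c.toReal) k) atTop atTop := by
      exact (Set.infinite_iff_tendsto_sum_indicator_atTop hc').1
        (Nat.frequently_atTop_iff_infinite.1 hu)
    refine tendsto_atTop_mono (fun n => Finset.sum_le_sum fun k _ => ?_) hmono
    by_cases hk : ω k = u
    · rw [Set.indicator_of_mem (by exact hk), hk]
      exact ENNReal.toReal_mono (PMF.apply_ne_top _ _) (hstep _)
    · rw [Set.indicator_of_notMem (by exact hk)]
      exact ENNReal.toReal_nonneg
  rw [mem_limsup_iff_frequently_mem] at h3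
  exact h3

lemma measurableSet_paths : MeasurableSet G.paths := by
  have : G.paths = ⋂ k, (fun ω : ℕ → V => (ω k, ω (k + 1))) ⁻¹' {p | 0 < G.δ p.1 p.2} := by
    ext; simp [paths]
  rw [this]
  exact .iInter fun k => (by fun_prop : Measurable _) .of_discrete

lemma measurableSet_reach (S : Set V) : MeasurableSet (G.reach S) := by
  have : G.reach S = G.paths ∩ ⋃ i, (fun ω : ℕ → V => ω i) ⁻¹' S := by
    ext; simp [reach]
  rw [this]
  exact measurableSet_paths.inter (.iUnion fun i => measurable_pi_apply i .of_discrete)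

lemma measurableSet_mem_infOften (v : V) : MeasurableSet {ω : ℕ → V | v ∈ infOften ω} := by
  have : {ω : ℕ → V | v ∈ infOften ω} = limsup (fun n => {ω : ℕ → V | ω n = v}) atTop := by
    ext ω
    rw [mem_limsup_iff_frequently_mem]
    rfl
  rw [this]
  exact .measurableSet_limsup fun n => measurableSet_eq_fun (by fun_prop) measurable_const

lemma measurableSet_fairPlays : MeasurableSet G.fairPlays := by
  have : G.fairPlays = G.paths ∩ ⋂ v, ⋂ (_ : G.owner v = Owner.player2), ⋂ w ∈ G.post v,
      {ω | v ∈ infOften ω}ᶜ ∪ {ω | w ∈ infOften ω} := by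
    ext ω
    simp only [fairPlays, Set.mem_inter_iff, Set.mem_iInter, Set.mem_union, Set.mem_compl_iff,
      Set.mem_ofPred_eq, Set.subset_def]
    refine and_congr_right fun _ => forall_congr' fun v => forall_congr' fun _ =>
      ⟨fun h w hw => ?_, fun h hv w hw => (h w hw).resolve_left (not_not.2 hv)⟩
    by_cases hv : v ∈ infOften ω
    · exact Or.inr (h hv w hw)
    · exact Or.inl hv
  rw [this]
  exact measurableSet_paths.inter (.iInter fun v => .iInter fun _ => .iInter fun w => .iInter
    fun _ => (measurableSet_mem_infOften v).compl.union (measurableSet_mem_infOften w))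

lemma ae_mem_paths (v : V) : ∀ᵐ ω ∂prob σ₁ σ₂ v, ω ∈ G.paths := by
  filter_upwards [ae_step_pos σ₁ σ₂ v] with ω hω k
  exact mem_post_of_step_pos σ₁ σ₂ _ (hω k)

lemma ae_infOften_chance (v : V) : ∀ᵐ ω ∂prob σ₁ σ₂ v, ∀ u, G.owner u = Owner.chance →
    u ∈ infOften ω → G.post u ⊆ infOften ω := by
  have : ∀ᵐ ω ∂prob σ₁ σ₂ v, ∀ u w, G.owner u = Owner.chance → w ∈ G.post u →
      u ∈ infOften ω → w ∈ infOften ω := by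
    simp only [ae_all_iff, eventually_imp_distrib_left]
    intro u w hu hw
    exact ae_infOften_of_step_ge σ₁ σ₂ v u w (ENNReal.ofReal_pos.2 hw)
      fun h => (step_of_chance_apply σ₁ σ₂ h hu w).ge
  filter_upwards [this] with ω hω u hu hinf w hw using hω u w hu hw hinf

lemma isFair_of_memoryless (hpos : ∀ h v w, w ∈ G.post v.1 → 0 < σ₂.next h v w)
    (hmem : ∀ h h' v, σ₂.next h v = σ₂.next h' v) : σ₂.IsFair := by
  intro σ₁ v
  rw [← mem_ae_iff_prob_eq_one measurableSet_fairPlays]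
  have : ∀ᵐ ω ∂prob σ₁ σ₂ v, ∀ u w, G.owner u = Owner.player2 → w ∈ G.post u →
      u ∈ infOften ω → w ∈ infOften ω := by
    simp only [ae_all_iff, eventually_imp_distrib_left]
    intro u w hu hw
    -- The uniform bound c is the move probability after the empty history.
    refine ae_infOften_of_step_ge σ₁ σ₂ v u w (hpos [] ⟨u, hu⟩ w hw) fun h => ?_
    rw [step_of_player2 σ₁ σ₂ h hu, hmem]
  filter_upwards [this, ae_mem_paths σ₁ σ₂ v] with ω hω hpath
  exact ⟨hpath, fun u hu hinf w hw => hω u w hu hw hinf⟩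

end Measure

/-! ### Predecessor operators and their least fixed points -/

section PreStar

lemma subset_preStar {V : Type*} (Pre : Set V → Set V) (C : Set V) : C ⊆ preStar Pre C :=
  Set.subset_sInter fun _ hX => hX.1

lemma preStar_subset {V : Type*} {Pre : Set V → Set V} {C X : Set V} (hC : C ⊆ X) (hX : Pre X ⊆ X) :
    preStar Pre C ⊆ X := Set.sInter_subset_of_mem ⟨hC, hX⟩

lemma pre_preStar_subset {V : Type*} {Pre : Set V → Set V} (hmono : Monotone Pre) (C : Set V) :
    Pre (preStar Pre C) ⊆ preStar Pre C :=
  Set.subset_sInter fun _ hX => (hmono (preStar_subset hX.1 hX.2)).trans hX.2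

lemma δSet_pos_iff (v : V) (C : Set V) : 0 < G.δSet v C ↔ ∃ w ∈ C, w ∈ G.post v := by
  have hnn : ∀ w ∈ Finset.univ, 0 ≤ C.indicator (G.δ v) w :=
    fun w _ => Set.indicator_nonneg (fun w _ => (G.δ_mem v w).1) w
  rw [δSet, Finset.sum_pos_iff_of_nonneg hnn]
  simp only [Finset.mem_univ, true_and]
  refine exists_congr fun w => ?_
  by_cases hw : w ∈ C <;> simp [hw, post]

lemma existsPre_mono : Monotone G.existsPre := fun C D hCD v hv => by
  obtain ⟨w, hw, h⟩ := (δSet_pos_iff v C).1 hv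
  exact (δSet_pos_iff v D).2 ⟨w, hCD hw, h⟩

lemma forallPre_mono : Monotone G.forallPre := fun C D hCD v hv => by
  rcases hv with ⟨ho, hv⟩ | ⟨ho, hv⟩
  · exact Or.inl ⟨ho, existsPre_mono hCD hv⟩
  · exact Or.inr ⟨ho, fun w hw => hCD (hv w hw)⟩

end PreStar

/-! ### Recurrent vertices and finite prefixes of paths -/

lemma exists_mem_infOften (ω : ℕ → V) : ∃ v, v ∈ infOften ω := by
  obtain ⟨v, hv⟩ := Finite.exists_infinite_fiber ω
  exact ⟨v, Nat.frequently_atTop_iff_infinite.2 (Set.infinite_coe_iff.1 hv)⟩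

lemma exists_post_mem_infOften {ω : ℕ → V} (hω : ω ∈ G.paths) {v : V} (hv : v ∈ infOften ω) :
    ∃ w ∈ G.post v, w ∈ infOften ω := by
  by_contra! hcon
  have h1 : ∀ w, ∀ᶠ n in atTop, w ∈ G.post v → ω n ≠ w := by
    intro w
    by_cases hw : w ∈ G.post v
    · exact (not_frequently.1 (hcon w hw)).mono fun _ h _ => h
    · exact Eventually.of_forall fun _ h => absurd h hw
  have h2 := (tendsto_add_atTop_nat 1).eventually (eventually_all.2 h1)
  obtain ⟨n, hn, hn'⟩ := (hv.and_eventually h2).exists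
  exact hn' (ω (n + 1)) (hn ▸ hω n) rfl

/-- The set of non-recurrent vertices contains C and is closed under `forallPre`: a recurrent Player
2 or chance vertex makes all its successors recur, a recurrent Player 1 vertex at least one. -/
lemma disjoint_infOften_of_fair {ω : ℕ → V} (hω : ω ∈ G.fairPlays)
    (hchance : ∀ u, G.owner u = Owner.chance → u ∈ infOften ω → G.post u ⊆ infOften ω)
    {C : Set V} (hC : ∀ i, ω i ∉ C) : preStar G.forallPre C ⊆ (infOften ω)ᶜ := by
  refine preStar_subset (fun v hv hinf => ?_) fun v hv hinf => ?_
  · obtain ⟨n, rfl⟩ := hinf.exists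
    exact hC n hv
  · rcases hv with ⟨ho, hv⟩ | ⟨ho, hv⟩
    · obtain ⟨w, hw, hp⟩ := (δSet_pos_iff v _).1 hv
      rcases ho with ho | ho
      · exact hw (hω.2 v ho hinf hp)
      · exact hw (hchance v ho hinf hp)
    · obtain ⟨w, hp, hw⟩ := exists_post_mem_infOften hω.1 hinf
      exact hv w hp hw

lemma mem_terminal_of_le {ω : ℕ → V} (hω : ω ∈ G.paths) {i j : ℕ} (hij : i ≤ j)
    (hi : ω i ∈ G.terminal) : ω j ∈ G.terminal := by
  induction j, hij using Nat.le_induction with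
  | base => exact hi
  | succ j _ ih =>
    by_cases h : ω j = ω (j + 1)
    · exact h ▸ ih
    · exact absurd (ih.2 _ h) (hω j).ne'

/-- Avoiding C before time n matters: with C = U, Player 1's moves are unrestricted along the
prefix. -/
lemma exists_prefix_of_mem_preStar {C : Set V} {v : V} (hv : v ∈ preStar G.existsPre C) :
    ∃ (p : ℕ → V) (n : ℕ), p 0 = v ∧ p n ∈ C ∧ ∀ i < n, p i ∉ C ∧ p (i + 1) ∈ G.post (p i) := by
  suffices h : preStar G.existsPre C ⊆ {v | ∃ (p : ℕ → V) (n : ℕ), p 0 = v ∧ p n ∈ C ∧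
      ∀ i < n, p i ∉ C ∧ p (i + 1) ∈ G.post (p i)} from h hv
  have base : C ⊆ {v | ∃ (p : ℕ → V) (n : ℕ), p 0 = v ∧ p n ∈ C ∧
      ∀ i < n, p i ∉ C ∧ p (i + 1) ∈ G.post (p i)} :=
    fun v hv => ⟨fun _ => v, 0, rfl, hv, by simp⟩
  refine preStar_subset base fun v hv => ?_
  by_cases hvC : v ∈ C
  · exact base hvC
  obtain ⟨w, ⟨p, n, rfl, hn, hp⟩, hw⟩ := (δSet_pos_iff v _).1 hv
  refine ⟨fun k => Nat.casesOn k v p, n + 1, rfl, hn, fun i hi => ?_⟩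
  cases i with
  | zero => exact ⟨hvC, hw⟩
  | succ i => exact hp i (by omega)

/-! ### The two directions -/

section Main

variable [MeasurableSpace V] [DiscreteMeasurableSpace V]

theorem prob_reach_eq_one_of_notMem {C : Set V} {v : V}
    (hv : v ∉ preStar G.existsPre (Set.univ \ preStar G.forallPre C))
    (σ₁ : G.Strategy Owner.player1) {σ₂ : G.Strategy Owner.player2} (hσ₂ : σ₂.IsFair) :
    prob σ₁ σ₂ v (G.reach C) = 1 := by
  rw [← mem_ae_iff_prob_eq_one (measurableSet_reach C)]
  have hfair := (mem_ae_iff_prob_eq_one measurableSet_fairPlays).2 (hσ₂ σ₁ v)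
  filter_upwards [hfair, ae_infOften_chance σ₁ σ₂ v, ae_eq_start σ₁ σ₂ v] with ω hω hch h0
  refine ⟨hω.1, ?_⟩
  by_contra! hC
  have hout : ∀ n, ω n ∉ preStar G.existsPre (Set.univ \ preStar G.forallPre C) := by
    intro n
    induction n with
    | zero => rwa [h0]
    | succ n ih =>
      exact fun h => ih (pre_preStar_subset existsPre_mono _ ((δSet_pos_iff _ _).2 ⟨_, h, hω.1 n⟩))
  obtain ⟨u, hu⟩ := exists_mem_infOften ω
  refine disjoint_infOften_of_fair hω hch hC ?_ hu
  obtain ⟨n, rfl⟩ := hu.exists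
  by_contra hn
  exact hout n (subset_preStar _ _ ⟨Set.mem_univ _, hn⟩)

theorem exists_prob_reach_terminal_ne_one {v : V}
    (hv : v ∈ preStar G.existsPre (Set.univ \ preStar G.forallPre G.terminal)) :
    ∃ (σ₁ : G.Strategy Owner.player1) (σ₂ : G.Strategy Owner.player2), σ₂.IsFair ∧
      prob σ₁ σ₂ v (G.reach G.terminal) ≠ 1 := by
  set U : Set V := Set.univ \ preStar G.forallPre G.terminal with hU
  have hUW : ∀ {u}, u ∉ U → u ∈ preStar G.forallPre G.terminal := fun {u} hu => by
    by_contra h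
    exact hu ⟨Set.mem_univ _, h⟩
  have hUpre : ∀ u ∈ U, u ∉ G.forallPre (preStar G.forallPre G.terminal) :=
    fun u hu h => hu.2 (pre_preStar_subset forallPre_mono _ h)
  have hUT : ∀ u ∈ U, u ∉ G.terminal := fun u hu h => hu.2 (subset_preStar _ _ h)
  -- Player 1 stays in `U` where possible.
  let S : V → Set V := fun u =>
    {w | w ∈ G.post u ∧ (u ∈ U → G.owner u = Owner.player1 → w ∈ U)}
  have hS : ∀ u, (S u).Nonempty := by
    intro u
    by_cases h : u ∈ U ∧ G.owner u = Owner.player1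
    · have : ∃ w, 0 < G.δ u w ∧ w ∉ preStar G.forallPre G.terminal := by
        by_contra! hcon
        exact hUpre u h.1 (Or.inr ⟨h.2, hcon⟩)
      obtain ⟨w, hw, hw'⟩ := this
      exact ⟨w, hw, fun _ _ => ⟨Set.mem_univ _, hw'⟩⟩
    · obtain ⟨w, hw⟩ := G.exists_succ u
      exact ⟨w, hw, fun h1 h2 => absurd ⟨h1, h2⟩ h⟩
  obtain ⟨σ₁, hσ₁, -⟩ := exists_strategy_next Owner.player1 S hS fun u w hw => hw.1
  obtain ⟨σ₂, hσ₂, hmem⟩ := exists_strategy_next Owner.player2 G.post G.exists_succ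
    fun _ => subset_rfl
  refine ⟨σ₁, σ₂, isFair_of_memoryless σ₂ (fun h v w => (hσ₂ h v w).2) hmem, fun hone => ?_⟩
  obtain ⟨p, n, h0, hn, hp⟩ := exists_prefix_of_mem_preStar hv
  have hpos : 0 < prob σ₁ σ₂ v {ω | ∀ i ≤ n, ω i = p i} := by
    refine prob_prefix_pos σ₁ σ₂ p h0 n fun i hi => ?_
    obtain ⟨hiU, hpost⟩ := hp i hi
    cases ho : G.owner (p i) with
    | player1 =>
      rw [step_of_player1 σ₁ σ₂ _ ho, hσ₁]
      exact ⟨hpost, fun h => absurd h hiU⟩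
    | player2 => rwa [step_of_player2 σ₁ σ₂ _ ho, hσ₂]
    | chance => rw [step_of_chance_apply σ₁ σ₂ _ ho]; exact ENNReal.ofReal_pos.2 hpost
  have hreach := (mem_ae_iff_prob_eq_one (measurableSet_reach _)).2 hone
  refine hpos.ne' (measure_eq_zero_iff_ae_notMem.2 ?_)
  filter_upwards [hreach, ae_step_pos σ₁ σ₂ v] with ω ⟨hpath, i, hi⟩ hstep hpre
  have hstay : ∀ m ≥ n, ω m ∈ U := by
    intro m hm
    induction m, hm using Nat.le_induction with
    | base => rwa [hpre n le_rfl]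
    | succ m _ ih =>
      by_contra hout
      cases ho : G.owner (ω m) with
      | player1 =>
        have := hstep m
        rw [step_of_player1 σ₁ σ₂ _ ho, hσ₁] at this
        exact hout (this.2 ih ho)
      | player2 =>
        exact hUpre _ ih (Or.inl ⟨Or.inl ho, (δSet_pos_iff _ _).2 ⟨_, hUW hout, hpath m⟩⟩)
      | chance =>
        exact hUpre _ ih (Or.inl ⟨Or.inr ho, (δSet_pos_iff _ _).2 ⟨_, hUW hout, hpath m⟩⟩)
  -- Since T is absorbing, a visit at time i, even before U is entered, puts the play in both T and
  -- U at time `max i n`.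
  exact hUT _ (hstay _ (le_max_right i n)) (mem_terminal_of_le hpath (le_max_left i n) hi)

end Main

end StochasticGame

theorem mainTheorem4 {V : Type*} [Fintype V] [MeasurableSpace V] [DiscreteMeasurableSpace V]
    (G : StochasticGame V) :
    (∀ v : V,
      (∀ (σ₁ : G.Strategy Owner.player1) (σ₂ : G.Strategy Owner.player2), σ₂.IsFair →
        StochasticGame.prob σ₁ σ₂ v (G.reach G.terminal) = 1) ↔
      v ∈ Set.univ \ preStar G.existsPre (Set.univ \ preStar G.forallPre G.terminal)) ∧
    (G.StoppingUnderFairness ↔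
      preStar G.existsPre (Set.univ \ preStar G.forallPre G.terminal) = ∅) := by
  have key : ∀ v : V,
      (∀ (σ₁ : G.Strategy Owner.player1) (σ₂ : G.Strategy Owner.player2), σ₂.IsFair →
        StochasticGame.prob σ₁ σ₂ v (G.reach G.terminal) = 1) ↔
      v ∉ preStar G.existsPre (Set.univ \ preStar G.forallPre G.terminal) := by
    refine fun v => ⟨fun h hv => ?_, fun hv σ₁ σ₂ hσ₂ =>
      StochasticGame.prob_reach_eq_one_of_notMem hv σ₁ hσ₂⟩
    obtain ⟨σ₁, σ₂, hσ₂, hne⟩ := StochasticGame.exists_prob_reach_terminal_ne_one hv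
    exact hne (h σ₁ σ₂ hσ₂)
  refine ⟨fun v => by simpa using key v, ?_⟩
  rw [Set.eq_empty_iff_forall_notMem]
  exact ⟨fun h v => (key v).1 fun σ₁ σ₂ hσ₂ => h σ₁ σ₂ hσ₂ v,
    fun h σ₁ σ₂ hσ₂ v => (key v).2 (h v) σ₁ σ₂ hσ₂⟩
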